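/- **Setting.** Let $V$ be a set of $n\ge 1$ nodes, $\lambda\in(0,1)$ and $k\in\mathbb N$. For a directed graph $G$ on $V$, $\mathrm{PageRank}_G$ is the stationary distribution of the Markov chain that, with probability $\lambda$, jumps to a uniformly random node and, with probability $1-\lambda$, moves to a uniformly random out-neighbour of the current node (to a uniformly random node of $V$ if there is no out-neighbour). A random walk of $\mathrm{Geom}(\lambda)$ length from $v$ in $G$ makes $\ell$ steps, where $\Pr[\ell=j]=(1-\lambda)^j\lambda$ for $j\ge 0$, each to a uniformly random out-neighbour (it ends early at a node without out-neighbours). **Process.** There are $k$ walks for each starting node $v\in V$. At time $1$ an adaptive adversary chooses a directed graph $G_1$ on $V$ and all $nk$ walks are sampled independently in $G_1$; this counts as a sampling by the adversary. At every later time $t$ the adversary, as a function of the whole history (graphs and walks at all times before $t$), chooses an arbitrary directed graph $G_t$ on $V$ and a set of walks; the walks of this set, and all walks that traverse an edge of $G_{t-1}$ missing from $G_t$, are sampled by the adversary at time $t$. If the adversary samples a walk at time $t_0$, landmark resampling schedules resamples of it at the times $t_1<t_2<\dots$, where $t_i=t_{i-1}+2^i+x_i$ and $x_i\in\{0,\dots,2^i\}$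 maximizes the number of trailing zeros of $t_i$ in binary. All walks which the adversary samples at time $t$ or which are scheduled for time $t$ are drawn afresh, independently, in $G_t$; all other walks stay as they are. Let $$\widehat{\mathrm{PageRank}}{}^{t}(v)=\frac{H^t_v}{nk/\lambda},$$ where $H_v^t$ is the number of walks that pass through $v$ at time $t$, and let $\mathrm{PageRank}^t=\mathrm{PageRank}_{G_t}$. **Theorem.** For all $\kappa>0$ and $c>0$ there is a constant $C>0$, depending only on $\kappa$ and $c$, such that for all $n\ge 1$, $\lambda\in(0,1)$ and $k\ge\kappa\log n$, for every adaptive adversary and every horizon $N$, with probability at least $1-n^{-c}$ the following holds simultaneously for all times $1\le T\le N$ and all nodes $v\in V$: $$\widehat{\mathrm{PageRank}}{}^{T}(v)\;\le\; C\log(T+1)\cdot\max_{1\le t'\le T}\mathrm{PageRank}^{t'}(v).$$ -/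

import Mathlib

noncomputable section

namespace DynPageRank

/-! ### Directed graphs and PageRank -/

section PageRank

variable {V : Type*} [Fintype V]

open Classical in
/-- The set of out-neighbours of `u`. -/
def outNbrs (G : Digraph V) (u : V) : Finset V :=
  Finset.univ.filter fun w => G.Adj u w

open Classical in
/-- Transition probabilities of moving to a uniformly random out-neighbour. A node without
out-neighbours moves to a uniformly random node of the graph. -/
def moveProb (G : Digraph V) (u w : V) : ℝ :=
  if outNbrs G u = ∅ then 1 / (Fintype.card V : ℝ)
  else if w ∈ outNbrs G u then 1 / ((outNbrs G u).card : ℝ) else 0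

/-- Transition probabilities of the PageRank chain: with probability `lam` jump to a uniformly
random node, with probability `1 - lam` move to a uniformly random out-neighbour. -/
def pageRankProb (lam : ℝ) (G : Digraph V) (u w : V) : ℝ :=
  lam * (1 / (Fintype.card V : ℝ)) + (1 - lam) * moveProb G u w

/-- `π` is a stationary probability distribution of the PageRank chain of `G`. -/
def IsPageRank (lam : ℝ) (G : Digraph V) (π : V → ℝ) : Prop :=
  π ∈ stdSimplex ℝ V ∧ ∀ w, ∑ u, π u * pageRankProb lam G u w = π w

theorem moveProb_nonneg (G : Digraph V) (u w : V) : 0 ≤ moveProb G u w := by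
  unfold moveProb
  split_ifs <;> positivity

theorem sum_moveProb [Nonempty V] (G : Digraph V) (u : V) : ∑ w, moveProb G u w = 1 := by
  classical
  unfold moveProb
  split_ifs with h
  · simp
  · rw [Finset.sum_ite_mem]
    have : ((outNbrs G u).card : ℝ) ≠ 0 := by
      simpa [Finset.card_eq_zero] using h
    simp [this]

theorem sum_mul_moveProb [Nonempty V] (G : Digraph V) (f : V → ℝ) :
    ∑ w, ∑ u, f u * moveProb G u w = ∑ u, f u := by
  rw [Finset.sum_comm]
  simp [← Finset.mul_sum, sum_moveProb]

theorem sum_abs_le [Nonempty V] (G : Digraph V) (f : V → ℝ) :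
    ∑ w, |∑ u, f u * moveProb G u w| ≤ ∑ u, |f u| := by
  rw [← sum_mul_moveProb G fun u => |f u|]
  refine Finset.sum_le_sum fun w _ => (Finset.abs_sum_le_sum_abs _ _).trans ?_
  refine Finset.sum_le_sum fun u _ => ?_
  rw [abs_mul, abs_of_nonneg (moveProb_nonneg G u w)]

/-- A vector fixed by the substochastic part of the chain vanishes. -/
theorem eq_zero_of_fixed [Nonempty V] {lam : ℝ} (h0 : 0 < lam) (h1 : lam < 1) (G : Digraph V)
    (d : V → ℝ) (hd : ∀ w, d w = (1 - lam) * ∑ u, d u * moveProb G u w) : d = 0 := by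
  have hle : ∑ w, |d w| ≤ (1 - lam) * ∑ w, |d w| := by
    calc ∑ w, |d w| = (1 - lam) * ∑ w, |∑ u, d u * moveProb G u w| := by
          rw [Finset.mul_sum]
          refine Finset.sum_congr rfl fun w _ => ?_
          conv_lhs => rw [hd w]
          rw [abs_mul, abs_of_pos (by linarith : 0 < 1 - lam)]
      _ ≤ _ := mul_le_mul_of_nonneg_left (sum_abs_le G d) (by linarith)
  have hnn : 0 ≤ ∑ w, |d w| := Finset.sum_nonneg fun _ _ => abs_nonneg _
  have hz : ∑ w, |d w| = 0 := by nlinarith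
  rw [Finset.sum_eq_zero_iff_of_nonneg fun _ _ => abs_nonneg _] at hz
  funext w
  simpa using hz w (Finset.mem_univ w)

theorem sum_pageRankProb_eq (lam : ℝ) (G : Digraph V) (π : V → ℝ) (hπ : ∑ u, π u = 1) (w : V) :
    ∑ u, π u * pageRankProb lam G u w
      = lam * (1 / (Fintype.card V : ℝ)) + (1 - lam) * ∑ u, π u * moveProb G u w := by
  unfold pageRankProb
  simp only [mul_add, Finset.sum_add_distrib, ← Finset.sum_mul, hπ, one_mul, Finset.mul_sum]
  congr 1
  exact Finset.sum_congr rfl fun u _ => by ring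

/-- For `0 < lam < 1` the PageRank chain has exactly one stationary distribution. -/
theorem existsUnique_isPageRank [Nonempty V] {lam : ℝ} (h0 : 0 < lam) (h1 : lam < 1)
    (G : Digraph V) : ∃! π : V → ℝ, IsPageRank lam G π := by
  let L : (V → ℝ) →ₗ[ℝ] (V → ℝ) :=
    { toFun := fun d w => d w - (1 - lam) * ∑ u, d u * moveProb G u w
      map_add' := by
        intro a b; funext w
        simp only [Pi.add_apply, add_mul, Finset.sum_add_distrib]; ring
      map_smul' := by
        intro c a; funext w
        simp only [Pi.smul_apply, smul_eq_mul, RingHom.id_apply, mul_assoc, ← Finset.mul_sum]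
        ring }
  have hL : ∀ d w, L d w = d w - (1 - lam) * ∑ u, d u * moveProb G u w := fun _ _ => rfl
  have hinj : Function.Injective L := by
    rw [← LinearMap.ker_eq_bot, LinearMap.ker_eq_bot']
    intro d hd
    refine eq_zero_of_fixed h0 h1 G d fun w => ?_
    have := congrFun hd w
    rw [hL] at this
    simpa [sub_eq_zero] using this
  obtain ⟨π, hπ⟩ := (LinearMap.injective_iff_surjective.1 hinj)
    (fun _ => lam * (1 / (Fintype.card V : ℝ)))
  have hfix : ∀ w, π w
      = lam * (1 / (Fintype.card V : ℝ)) + (1 - lam) * ∑ u, π u * moveProb G u w := by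
    intro w
    have := congrFun hπ w
    rw [hL] at this
    linarith
  have hcard : ∑ _w : V, lam * (1 / (Fintype.card V : ℝ)) = lam := by
    have : (Fintype.card V : ℝ) ≠ 0 := by simp
    rw [Finset.sum_const, Finset.card_univ, nsmul_eq_mul]
    field_simp
  have hsum : ∑ w, π w = 1 := by
    have : ∑ w, π w = lam + (1 - lam) * ∑ w, π w := by
      conv_lhs => rw [Finset.sum_congr rfl fun w _ => hfix w]
      rw [Finset.sum_add_distrib, hcard, ← Finset.mul_sum, sum_mul_moveProb]
    nlinarith
  have habs : ∑ w, |π w| ≤ 1 := by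
    have : ∑ w, |π w| ≤ lam + (1 - lam) * ∑ w, |π w| := by
      calc ∑ w, |π w| ≤ ∑ w, (lam * (1 / (Fintype.card V : ℝ))
              + (1 - lam) * |∑ u, π u * moveProb G u w|) := by
            refine Finset.sum_le_sum fun w _ => ?_
            conv_lhs => rw [hfix w]
            refine (abs_add_le _ _).trans (le_of_eq ?_)
            rw [abs_mul (1 - lam), abs_of_pos (by linarith : 0 < 1 - lam), abs_of_nonneg]
            positivity
        _ = lam + (1 - lam) * ∑ w, |∑ u, π u * moveProb G u w| := by
            rw [Finset.sum_add_distrib, hcard, ← Finset.mul_sum]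
        _ ≤ _ := by
            have := mul_le_mul_of_nonneg_left (sum_abs_le G π) (by linarith : 0 ≤ 1 - lam)
            linarith
    nlinarith
  have hnn : ∀ w, 0 ≤ π w := by
    have h2 : ∑ w, (|π w| - π w) = 0 := by
      refine le_antisymm ?_ (Finset.sum_nonneg fun w _ => sub_nonneg.2 (le_abs_self _))
      rw [Finset.sum_sub_distrib, hsum]; linarith
    rw [Finset.sum_eq_zero_iff_of_nonneg fun w _ => sub_nonneg.2 (le_abs_self _)] at h2
    intro w
    have := h2 w (Finset.mem_univ w)
    have h3 := abs_nonneg (π w)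
    linarith
  refine ⟨π, ⟨⟨hnn, hsum⟩, fun w => ?_⟩, ?_⟩
  · rw [sum_pageRankProb_eq lam G π hsum w, ← hfix w]
  · rintro ρ ⟨⟨_, hρs⟩, hρ⟩
    have : ρ - π = 0 := by
      refine eq_zero_of_fixed h0 h1 G _ fun w => ?_
      have e := hρ w
      rw [sum_pageRankProb_eq lam G ρ hρs w] at e
      have e' := hfix w
      simp only [Pi.sub_apply, sub_mul, Finset.sum_sub_distrib]
      linarith
    exact sub_eq_zero.1 this

open Classical in
/-- The PageRank vector of `G`: the stationary distribution of the PageRank chain, which exists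
and is unique by `existsUnique_isPageRank`. -/
def pageRank (lam : ℝ) (G : Digraph V) : V → ℝ :=
  if h : ∃ π, IsPageRank lam G π then h.choose else 0

theorem isPageRank_pageRank [Nonempty V] {lam : ℝ} (h0 : 0 < lam) (h1 : lam < 1)
    (G : Digraph V) : IsPageRank lam G (pageRank lam G) := by
  have h := (existsUnique_isPageRank h0 h1 G).exists
  unfold pageRank
  rw [dif_pos h]
  exact h.choose_spec

end PageRank

/-! ### Random walks -/

section Walks

variable {V : Type*} [Fintype V]

open Classical in
/-- The law of the node sequence of a random walk in `G` that starts at `v` and makes `l` steps,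
each to a uniformly random out-neighbour of the current node. The walk ends early when it is at a
node without out-neighbours. -/
def fixedLengthWalk (G : Digraph V) : ℕ → V → PMF (List V)
  | 0, v => PMF.pure [v]
  | l + 1, v =>
    if h : (outNbrs G v).Nonempty then
      (PMF.uniformOfFinset (outNbrs G v) h).bind fun w =>
        (fixedLengthWalk G l w).map fun p => v :: p
    else PMF.pure [v]

/-- The geometric distribution, `P(l) = (1 - lam) ^ l * lam` for `l = 0, 1, 2, …`. -/
def geomLength (lam : Set.Ioo (0 : ℝ) 1) : PMF ℕ :=
  (ProbabilityTheory.geometricMeasure ⟨lam, lam.2.1.le, lam.2.2.le⟩).toPMF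

/-- The law of a random walk from `v` whose number of steps is geometric, that is, of a walk which
stops with probability `lam` at every node it is at. -/
def walkLaw (lam : Set.Ioo (0 : ℝ) 1) (G : Digraph V) (v : V) : PMF (List V) :=
  (geomLength lam).bind fun l => fixedLengthWalk G l v

/-- The walk with node sequence `p` traverses the edge from `a` to `b`. -/
def Traverses (p : List V) (a b : V) : Prop := [a, b] <:+: p

end Walks

/-- The joint law of independent random elements with laws `p i`. -/
def prodPMF {ι α : Type*} [Fintype ι] [Countable α] (p : ι → PMF α) : PMF (ι → α) :=
  ⟨fun f => ∏ i, p i (f i), by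
    let _ : MeasurableSpace α := ⊤
    have h := (MeasureTheory.Measure.pi fun i => (p i).toMeasure).toPMF.hasSum_coe_one
    convert h using 1
    funext f
    rw [MeasureTheory.Measure.toPMF_apply, MeasureTheory.Measure.pi_singleton]
    exact Finset.prod_congr rfl fun i _ =>
      ((p i).toMeasure_apply_singleton _ (MeasurableSet.singleton _)).symm⟩

/-! ### Landmark resampling -/

theorem exists_landmark (i s : ℕ) :
    ∃ t ∈ Finset.Icc (s + 2 ^ i) (s + 2 ^ i + 2 ^ i),
      ∀ t' ∈ Finset.Icc (s + 2 ^ i) (s + 2 ^ i + 2 ^ i), padicValNat 2 t' ≤ padicValNat 2 t :=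
  Finset.exists_max_image _ _ ⟨s + 2 ^ i, by simp⟩

/-- The number `s + 2 ^ i + x` with `0 ≤ x ≤ 2 ^ i` that has the largest number of trailing zeros
in binary; `padicValNat 2 t` is the number of trailing zeros of `t`. -/
def nextLandmark (i s : ℕ) : ℕ := (exists_landmark i s).choose

/-- The times `t_0, t_1, t_2, …`: the object is sampled by the adversary at time `t_0` and
scheduled for resampling at the times `t_i`, `i ≥ 1`. -/
def landmarkTime (t0 : ℕ) : ℕ → ℕ
  | 0 => t0
  | i + 1 => nextLandmark (i + 1) (landmarkTime t0 i)

/-! ### The interaction of the adversary with landmark resampling -/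

section Dynamics

variable {V : Type*} {k : ℕ}

/-- The record of one time step. The objects are the pairs `(v, j)`, standing for the `j`-th random
walk from `v`. -/
structure Snapshot (V : Type*) (k : ℕ) where
  /-- the graph at this time -/
  graph : Digraph V
  /-- the walks sampled by the adversary at this time -/
  advSampled : Set (V × Fin k)
  /-- the realization of every walk at this time -/
  walk : V × Fin k → List V

/-- The history of the process, latest time step first. The history `S :: h` ends with the
snapshot `S` of time `h.length + 1`. -/
abbrev History (V : Type*) (k : ℕ) := List (Snapshot V k)

/-- An adaptive adversary: given the history it chooses the next graph on the same nodes, and a set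
of walks to be resampled in it. -/
structure Adversary (V : Type*) (k : ℕ) where
  /-- the next graph -/
  graph : History V k → Digraph V
  /-- the walks designated for resampling -/
  resample : History V k → Set (V × Fin k)

/-- The realizations after the given history. -/
def currentWalk : History V k → V × Fin k → List V
  | [], _ => []
  | S :: _, u => S.walk u

/-- The walks that the adversary samples in the step after the history: all walks at the first time
step; later the designated walks and the walks that traverse a deleted edge. -/
def advSample (A : Adversary V k) : History V k → Set (V × Fin k)
  | [] => Set.univ
  | S :: h => A.resample (S :: h) ∪
      {u | ∃ a b, Traverses (S.walk u) a b ∧ S.graph.Adj a b ∧ ¬ (A.graph (S :: h)).Adj a b}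

/-- The walks that landmark resampling resamples in the step after the history `h`, at time
`h.length + 1`: those which the adversary sampled at an earlier time `t0 = past.length + 1` with
`h.length + 1` among the scheduled times `t_1, t_2, …`. -/
def algSample (h : History V k) : Set (V × Fin k) :=
  {u | ∃ (S : Snapshot V k) (past : History V k), S :: past <:+ h ∧ u ∈ S.advSampled ∧
    ∃ i, 1 ≤ i ∧ landmarkTime (past.length + 1) i = h.length + 1}

variable [Fintype V]

open Classical in
/-- The law of the next snapshot: the walks sampled by the adversary or by the algorithm are drawn
independently in the next graph, the other walks persist. -/
def nextLaw (lam : Set.Ioo (0 : ℝ) 1) (A : Adversary V k) (h : History V k) :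
    PMF (Snapshot V k) :=
  (prodPMF fun u : V × Fin k =>
    if u ∈ advSample A h ∪ algSample h then walkLaw lam (A.graph h) u.1
    else PMF.pure (currentWalk h u)).map
  fun w => ⟨A.graph h, advSample A h, w⟩

/-- The law of the history of the first `N` time steps. -/
def historyLaw (lam : Set.Ioo (0 : ℝ) 1) (A : Adversary V k) : ℕ → PMF (History V k)
  | 0 => PMF.pure []
  | t + 1 => (historyLaw lam A t).bind fun h => (nextLaw lam A h).map fun S => S :: h

open Classical in
/-- The number of walks that pass through `v` after the given history. -/
def hits (h : History V k) (v : V) : ℕ :=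
  (Finset.univ.filter fun u : V × Fin k => v ∈ currentWalk h u).card

/-- The estimated PageRank of `v` after the given history. -/
def estPageRank (lam : ℝ) (h : History V k) (v : V) : ℝ :=
  (hits h v : ℝ) / ((Fintype.card V : ℝ) * k / lam)

/-- The largest PageRank that `v` has had during the given history (PageRanks are nonnegative, so
that starting the maximum at `0` has no effect on a nonempty history). -/
def maxPageRank (lam : ℝ) (h : History V k) (v : V) : ℝ :=
  (h.map fun S => pageRank lam S.graph v).foldr max 0

end Dynamics

end DynPageRank

end

/-!
Fix a node `v` and a time `T`. A walk that passes through `v` at time `T` was drawn for the last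
time at some `s ≤ T`, and it passed through `v` when it was drawn. Landmark resampling leaves few
candidates for `s`: if the last drawing was the `i`-th resampling after a sampling by the adversary,
then `2 ^ i` divides `s`, since the window from which the landmark is chosen contains a multiple of
`2 ^ i`; and the next resampling, due at most `2 ^ (i + 2)` steps later, has not yet happened. So
`s` lies in a set `lastTimes T` of `O(log T)` times which does not depend on the walk or on the
adversary (`Consistent.length_mem_lastTimes`, `card_lastTimes_le_log`).

At a single time `s` the walks that are drawn are independent given the past, whichever of them the
adversary has selected, and the expected number of those passing through `v` is at most `nk / lam`
times the PageRank of `v` at time `s`. This follows by integrating the first-step inequality of the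
hitting probabilities against the stationary distribution (`sum_hitProb_le`). Hence, with `X` the
number of passages at the times in `lastTimes T` and `Y` the sum of the bounds on their conditional
expectations, `2 ^ X * exp (-Y)` is a supermartingale (`expect_expWeight_le_one`). It copes with
adaptivity: although the PageRanks are random, `Y` is at most `12 * log (T + 1) * M`, where `M` is
`nk / lam` times the maximal PageRank of `v` so far. So if the estimate exceeds the bound, then the
supermartingale is at least `exp (D * log (T + 1) * M / κ)`, where the constant `D` grows with the
constant of the bound. Every PageRank is at least `lam / n`, whence `M ≥ k ≥ κ * log n`, and Markov's inequality gives a failure probability that is summable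
over `T` and beats the union bound over `v` (`card_mul_exp_le`).
-/

open scoped ENNReal

noncomputable section

namespace DynPageRank

/-! ### Expectations under discrete laws -/

section Expectation

variable {α β ι : Type*}

/-- The expectation of a nonnegative function under a discrete law. -/
def expect (p : PMF α) (f : α → ℝ≥0∞) : ℝ≥0∞ := ∑' a, p a * f a

theorem expect_mono (p : PMF α) {f g : α → ℝ≥0∞} (h : ∀ a ∈ p.support, f a ≤ g a) :
    expect p f ≤ expect p g := by
  refine ENNReal.tsum_le_tsum fun a => ?_
  by_cases ha : p a = 0
  · simp [ha]
  · gcongr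
    exact h a ha

theorem expect_const (p : PMF α) (c : ℝ≥0∞) : expect p (fun _ => c) = c := by
  simp [expect, ENNReal.tsum_mul_right, p.tsum_coe]

theorem expect_add (p : PMF α) (f g : α → ℝ≥0∞) :
    expect p (fun a => f a + g a) = expect p f + expect p g := by
  simp [expect, mul_add, ENNReal.tsum_add]

theorem expect_mul_left (p : PMF α) (c : ℝ≥0∞) (f : α → ℝ≥0∞) :
    expect p (fun a => c * f a) = c * expect p f := by
  simp [expect, mul_left_comm, ENNReal.tsum_mul_left]

theorem expect_pure (a : α) (f : α → ℝ≥0∞) : expect (PMF.pure a) f = f a := by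
  unfold expect
  rw [tsum_eq_single a fun b hb => by rw [PMF.pure_apply_of_ne _ _ hb, zero_mul]]
  simp

theorem expect_bind (p : PMF α) (q : α → PMF β) (f : β → ℝ≥0∞) :
    expect (p.bind q) f = expect p fun a => expect (q a) f := by
  simp only [expect, PMF.bind_apply, ← ENNReal.tsum_mul_right, ← ENNReal.tsum_mul_left]
  rw [ENNReal.tsum_comm]
  simp only [mul_assoc]

theorem expect_map (p : PMF α) (g : α → β) (f : β → ℝ≥0∞) :
    expect (p.map g) f = expect p fun a => f (g a) := by
  rw [← PMF.bind_pure_comp, expect_bind]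
  simp [expect_pure]

open Classical in
theorem toOuterMeasure_eq_expect (p : PMF α) (s : Set α) :
    p.toOuterMeasure s = expect p fun a => if a ∈ s then 1 else 0 := by
  rw [PMF.toOuterMeasure_apply]
  refine tsum_congr fun a => ?_
  by_cases h : a ∈ s <;> simp [h]

/-- Tonelli's theorem for sums of finite products. -/
theorem tsum_prod_eq_prod_tsum [Fintype ι] (g : ι → α → ℝ≥0∞) :
    ∑' f : ι → α, ∏ i, g i (f i) = ∏ i, ∑' a, g i a := by
  refine Fintype.induction_empty_option
    (P := fun ι _ => ∀ g : ι → α → ℝ≥0∞, ∑' f : ι → α, ∏ i, g i (f i) = ∏ i, ∑' a, g i a)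
    (fun ι κ _ e ih g => ?_) (fun g => by simp) (fun ι _ ih g => ?_) ι g
  · let _ : Fintype ι := Fintype.ofEquiv κ e.symm
    rw [← e.prod_comp, ← ih, ← (e.arrowCongr (Equiv.refl α)).tsum_eq]
    refine tsum_congr fun f => ?_
    rw [← e.prod_comp]
    simp
  · rw [← Equiv.piOptionEquivProd.symm.tsum_eq, ENNReal.tsum_prod']
    simp only [Fintype.prod_option, Equiv.piOptionEquivProd, Equiv.coe_fn_symm_mk]
    simp only [ENNReal.tsum_mul_left, ENNReal.tsum_mul_right]
    rw [ih]

/-- Expectations of products of functions of independent variables factorize. -/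
theorem expect_prodPMF [Fintype ι] [Countable α] (p : ι → PMF α) (f : ι → α → ℝ≥0∞) :
    expect (prodPMF p) (fun w => ∏ i, f i (w i)) = ∏ i, expect (p i) (f i) := by
  unfold expect
  rw [← tsum_prod_eq_prod_tsum]
  refine tsum_congr fun w => ?_
  rw [Finset.prod_mul_distrib]
  rfl

end Expectation

/-! ### The probability that a random walk passes through a node -/

section HitProb

variable {V : Type*}

open Classical in
/-- The indicator that the walk with node sequence `p` passes through `v`. -/
def passes (v : V) (p : List V) : ℝ≥0∞ := if v ∈ p then 1 else 0

theorem passes_le_one (v : V) (p : List V) : passes v p ≤ 1 := by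
  unfold passes; split_ifs <;> simp

theorem passes_cons_of_ne {v w : V} (h : w ≠ v) (p : List V) :
    passes v (w :: p) = passes v p := by
  have hmem : v ∈ w :: p ↔ v ∈ p := by simp [h.symm]
  unfold passes
  split_ifs <;> tauto

variable [Fintype V]

/-- The probability that a walk of geometric length from `w` passes through `v`. -/
def hitProb (lam : Set.Ioo (0 : ℝ) 1) (G : Digraph V) (v w : V) : ℝ≥0∞ :=
  expect (walkLaw lam G w) (passes v)

theorem hitProb_le_one (lam : Set.Ioo (0 : ℝ) 1) (G : Digraph V) (v w : V) :
    hitProb lam G v w ≤ 1 :=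
  (expect_mono _ fun p _ => passes_le_one v p).trans_eq (expect_const _ 1)

theorem geomLength_apply (lam : Set.Ioo (0 : ℝ) 1) (l : ℕ) :
    geomLength lam l = ENNReal.ofReal ((1 - lam) ^ l * lam) := by
  unfold geomLength
  rw [MeasureTheory.Measure.toPMF_apply, ProbabilityTheory.geometricMeasure_singleton]
  intro h
  exact lam.2.1.ne' (congrArg Subtype.val h)

theorem geomLength_succ (lam : Set.Ioo (0 : ℝ) 1) (l : ℕ) :
    geomLength lam (l + 1) = ENNReal.ofReal (1 - lam) * geomLength lam l := by
  rw [geomLength_apply, geomLength_apply, ← ENNReal.ofReal_mul (by linarith [lam.2.2])]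
  congr 1
  ring

theorem expect_fixedLengthWalk_succ_le (G : Digraph V) {v w : V} (hw : w ≠ v) (l : ℕ) :
    expect (fixedLengthWalk G (l + 1) w) (passes v) ≤
      ∑ x, ENNReal.ofReal (moveProb G w x) * expect (fixedLengthWalk G l x) (passes v) := by
  classical
  rw [fixedLengthWalk]
  split_ifs with h
  · simp only [expect_bind, expect_map, passes_cons_of_ne hw]
    rw [expect, tsum_fintype]
    refine Finset.sum_le_sum fun x _ => ?_
    gcongr
    have hne : outNbrs G w ≠ ∅ := h.ne_empty
    have hc : 0 < (outNbrs G w).card := h.card_pos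
    by_cases hx : x ∈ outNbrs G w
    · rw [PMF.uniformOfFinset_apply_of_mem _ hx, moveProb, if_neg hne, if_pos hx, one_div,
        ENNReal.ofReal_inv_of_pos (by exact_mod_cast hc), ENNReal.ofReal_natCast]
    · rw [PMF.uniformOfFinset_apply_of_notMem _ hx]
      exact zero_le
  · rw [expect_pure]
    simp [passes, hw.symm]

/-- A walk from `w ≠ v` can pass through `v` only after a first step. As the number of steps is
memoryless, it then continues like a fresh walk. -/
theorem hitProb_le_of_ne (lam : Set.Ioo (0 : ℝ) 1) (G : Digraph V) {v w : V} (hw : w ≠ v) :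
    hitProb lam G v w ≤ ENNReal.ofReal (1 - lam) *
      ∑ x, ENNReal.ofReal (moveProb G w x) * hitProb lam G v x := by
  have hexp : ∀ x, hitProb lam G v x =
      ∑' l, geomLength lam l * expect (fixedLengthWalk G l x) (passes v) := fun x => by
    rw [hitProb, walkLaw, expect_bind]
    rfl
  rw [hexp w, tsum_eq_zero_add' ENNReal.summable]
  have h0 : expect (fixedLengthWalk G 0 w) (passes v) = 0 := by
    rw [fixedLengthWalk, expect_pure]
    simp [passes, hw.symm]
  rw [h0, mul_zero, zero_add]
  calc ∑' l, geomLength lam (l + 1) * expect (fixedLengthWalk G (l + 1) w) (passes v)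
      ≤ ∑' l, ENNReal.ofReal (1 - lam) * ∑ x, ENNReal.ofReal (moveProb G w x) *
          (geomLength lam l * expect (fixedLengthWalk G l x) (passes v)) := by
        refine ENNReal.tsum_le_tsum fun l => ?_
        rw [geomLength_succ, mul_assoc]
        gcongr
        refine (mul_le_mul_right (expect_fixedLengthWalk_succ_le G hw l) _).trans_eq ?_
        rw [Finset.mul_sum]
        exact Finset.sum_congr rfl fun x _ => mul_left_comm _ _ _
    _ = _ := by
        rw [ENNReal.tsum_mul_left, Summable.tsum_finsetSum fun _ _ => ENNReal.summable]
        simp only [ENNReal.tsum_mul_left, hexp]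

theorem pageRank_eq [Nonempty V] (lam : Set.Ioo (0 : ℝ) 1) (G : Digraph V) (w : V) :
    pageRank lam G w = lam * (1 / (Fintype.card V : ℝ))
      + (1 - lam) * ∑ u, pageRank lam G u * moveProb G u w := by
  obtain ⟨⟨-, hs⟩, h⟩ := isPageRank_pageRank lam.2.1 lam.2.2 G
  rw [← sum_pageRankProb_eq _ _ _ hs, h]

theorem pageRank_nonneg [Nonempty V] (lam : Set.Ioo (0 : ℝ) 1) (G : Digraph V) (w : V) :
    0 ≤ pageRank lam G w :=
  (isPageRank_pageRank lam.2.1 lam.2.2 G).1.1 w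

theorem le_pageRank [Nonempty V] (lam : Set.Ioo (0 : ℝ) 1) (G : Digraph V) (w : V) :
    lam * (1 / (Fintype.card V : ℝ)) ≤ pageRank lam G w := by
  rw [pageRank_eq]
  have : 0 ≤ ∑ u, pageRank lam G u * moveProb G u w :=
    Finset.sum_nonneg fun u _ => mul_nonneg (pageRank_nonneg lam G u) (moveProb_nonneg G u w)
  nlinarith [lam.2.2]

/-- Averaged over the starting node, a walk passes through `v` with probability at most
`pageRank v / lam`. Integrating the one-step inequality `hitProb_le_of_ne` against the stationary
distribution shows this without counting visits. -/
theorem sum_hitProb_le [Nonempty V] (lam : Set.Ioo (0 : ℝ) 1) (G : Digraph V) (v : V) :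
    ∑ w, (hitProb lam G v w).toReal ≤ Fintype.card V / lam * pageRank lam G v := by
  classical
  have h0 := lam.2.1
  have h1 := lam.2.2
  set q : V → ℝ := fun w => (hitProb lam G v w).toReal with hq
  set π := pageRank lam G with hπ
  have hfin : ∀ w, hitProb lam G v w ≠ ∞ := fun w =>
    ((hitProb_le_one lam G v w).trans_lt ENNReal.one_lt_top).ne
  have hnn : ∀ w, 0 ≤ q w := fun w => ENNReal.toReal_nonneg
  have hstep : ∀ w, q w ≤ (if w = v then 1 else 0) + (1 - lam) * ∑ x, moveProb G w x * q x := by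
    intro w
    have hs : 0 ≤ (1 - (lam : ℝ)) * ∑ x, moveProb G w x * q x :=
      mul_nonneg (by linarith)
        (Finset.sum_nonneg fun x _ => mul_nonneg (moveProb_nonneg G w x) (hnn x))
    split_ifs with hw
    · have : q w ≤ 1 := ENNReal.toReal_le_of_le_ofReal zero_le_one
        (by simpa using hitProb_le_one lam G v w)
      linarith
    · rw [zero_add]
      refine ENNReal.toReal_le_of_le_ofReal hs ((hitProb_le_of_ne lam G hw).trans_eq ?_)
      rw [ENNReal.ofReal_mul (by linarith), ENNReal.ofReal_sum_of_nonneg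
        fun x _ => mul_nonneg (moveProb_nonneg G w x) (hnn x)]
      congr 1
      refine Finset.sum_congr rfl fun x _ => ?_
      rw [ENNReal.ofReal_mul (moveProb_nonneg G w x), ENNReal.ofReal_toReal (hfin x)]
  have hint : ∑ w, π w * q w ≤ π v + ∑ x, ((1 - lam) * ∑ w, π w * moveProb G w x) * q x := by
    calc ∑ w, π w * q w
        ≤ ∑ w, π w * ((if w = v then 1 else 0) + (1 - lam) * ∑ x, moveProb G w x * q x) :=
          Finset.sum_le_sum fun w _ =>
            mul_le_mul_of_nonneg_left (hstep w) (pageRank_nonneg lam G w)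
      _ = _ := by
          simp only [mul_add, Finset.sum_add_distrib, mul_ite, mul_one, mul_zero,
            Finset.sum_ite_eq', Finset.mem_univ, if_true, Finset.mul_sum, Finset.sum_mul]
          rw [Finset.sum_comm]
          congr 1
          exact Finset.sum_congr rfl fun x _ => Finset.sum_congr rfl fun w _ => by ring
  have hx : ∀ x, (1 - lam) * ∑ w, π w * moveProb G w x
      = π x - lam * (1 / (Fintype.card V : ℝ)) := fun x => by
    have := pageRank_eq lam G x
    rw [← hπ] at this
    linarith
  simp only [hx, sub_mul, Finset.sum_sub_distrib, ← Finset.mul_sum] at hint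
  have hc : (0 : ℝ) < Fintype.card V := by exact_mod_cast Fintype.card_pos
  rw [div_mul_eq_mul_div, le_div_iff₀ h0]
  have : lam * (1 / (Fintype.card V : ℝ)) * ∑ x, q x ≤ π v := by linarith
  calc (∑ w, q w) * lam = Fintype.card V * (lam * (1 / (Fintype.card V : ℝ)) * ∑ x, q x) := by
        field_simp
    _ ≤ _ := mul_le_mul_of_nonneg_left this hc.le

end HitProb

/-! ### Few times can be the last sampling time of a walk -/

section Landmark

theorem nextLandmark_le (i s : ℕ) : nextLandmark i s ≤ s + 2 ^ (i + 1) := by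
  have := (Finset.mem_Icc.1 (exists_landmark i s).choose_spec.1).2
  rw [pow_succ]
  unfold nextLandmark
  omega

theorem lt_nextLandmark (i s : ℕ) : s < nextLandmark i s := by
  have := (Finset.mem_Icc.1 (exists_landmark i s).choose_spec.1).1
  have h2 : 0 < 2 ^ i := by positivity
  unfold nextLandmark
  omega

/-- An interval of `2 ^ i + 1` consecutive numbers contains a multiple of `2 ^ i`. -/
theorem two_pow_dvd_nextLandmark (i s : ℕ) : 2 ^ i ∣ nextLandmark i s := by
  have hpos : 0 < 2 ^ i := by positivity
  -- the least multiple of `2 ^ i` that is larger than `s + 2 ^ i`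
  set m := 2 ^ i * ((s + 2 ^ i) / 2 ^ i + 1) with hm
  have hdiv := Nat.div_add_mod (s + 2 ^ i) (2 ^ i)
  have hmod := Nat.mod_lt (s + 2 ^ i) hpos
  have hmem : m ∈ Finset.Icc (s + 2 ^ i) (s + 2 ^ i + 2 ^ i) := by
    rw [Finset.mem_Icc, hm, mul_add, mul_one]
    omega
  have hmax := (exists_landmark i s).choose_spec.2 m hmem
  have hne : nextLandmark i s ≠ 0 := (Nat.zero_le s |>.trans_lt (lt_nextLandmark i s)).ne'
  have hm0 : m ≠ 0 := by positivity
  rw [padicValNat_dvd_iff_le hne]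
  exact ((padicValNat_dvd_iff_le hm0).1 (Dvd.intro _ rfl)).trans hmax

open Classical in
/-- The times at most `T` that can be the time of the last sampling before `T` of a walk: the
multiples `s` of a power `2 ^ i` whose distance from `T` is less than `2 ^ (i + 2)`. -/
def lastTimes (T : ℕ) : Finset ℕ :=
  (Finset.Icc 1 T).filter fun s => ∃ i, 2 ^ i ∣ s ∧ T < s + 2 ^ (i + 2)

theorem card_lastTimes_le (T : ℕ) : (lastTimes T).card ≤ 4 * (Nat.log 2 T + 1) := by
  have hsub : lastTimes T ⊆ (Finset.range (Nat.log 2 T + 1)).biUnion fun i =>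
      (Finset.Ioc (T / 2 ^ i - 4) (T / 2 ^ i)).image fun m => 2 ^ i * m := by
    intro s hs
    simp only [lastTimes, Finset.mem_filter, Finset.mem_Icc] at hs
    obtain ⟨⟨h1, hT⟩, i, ⟨m, rfl⟩, hlt⟩ := hs
    have hpos : 0 < 2 ^ i := by positivity
    have hm : 0 < m := Nat.pos_of_mul_pos_left h1
    simp only [Finset.mem_biUnion, Finset.mem_range, Finset.mem_image, Finset.mem_Ioc]
    refine ⟨i, Nat.lt_succ_of_le (Nat.le_log_of_pow_le one_lt_two ?_), m, ⟨?_, ?_⟩, rfl⟩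
    · nlinarith
    · have : T / 2 ^ i < m + 4 := by
        rw [Nat.div_lt_iff_lt_mul hpos]
        rw [pow_add] at hlt
        nlinarith
      omega
    · rw [Nat.le_div_iff_mul_le hpos]
      linarith
  calc (lastTimes T).card ≤ _ := Finset.card_le_card hsub
    _ ≤ ∑ i ∈ Finset.range (Nat.log 2 T + 1), 4 := by
        refine Finset.card_biUnion_le.trans (Finset.sum_le_sum fun i _ => ?_)
        refine Finset.card_image_le.trans ?_
        rw [Nat.card_Ioc]
        omega
    _ = _ := by simp [mul_comm]

theorem card_lastTimes_le_log {T : ℕ} (hT : 1 ≤ T) :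
    ((lastTimes T).card : ℝ) ≤ 12 * Real.log (T + 1) := by
  have hc : ((lastTimes T).card : ℝ) ≤ 4 * (Nat.log 2 T + 1) := by
    exact_mod_cast card_lastTimes_le T
  have hT' : (1 : ℝ) ≤ T := by exact_mod_cast hT
  have hlog : (Nat.log 2 T : ℝ) * Real.log 2 ≤ Real.log (T + 1) := by
    rw [← Real.log_pow]
    refine Real.log_le_log (by positivity) ?_
    have : ((2 ^ Nat.log 2 T : ℕ) : ℝ) ≤ T := by
      exact_mod_cast Nat.pow_log_le_self 2 (by omega)
    push_cast at this
    linarith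
  have h2 : Real.log 2 ≤ Real.log (T + 1) := Real.log_le_log two_pos (by linarith)
  nlinarith [Real.log_two_gt_d9]

end Landmark

/-! ### Histories that the process can produce -/

section Consistency

variable {V : Type*} {k : ℕ}

/-- The walks which are drawn afresh in the step after the history. -/
def sampled (A : Adversary V k) (h : History V k) : Set (V × Fin k) :=
  advSample A h ∪ algSample h

/-- The recorded sets of walks sampled by the adversary are those which the adversary `A` chooses,
and walks that are not drawn afresh persist. -/
inductive Consistent (A : Adversary V k) : History V k → Prop
  | nil : Consistent A []
  | cons {S : Snapshot V k} {h : History V k} (hh : Consistent A h)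
      (hadv : S.advSampled = advSample A h)
      (hwalk : ∀ u, u ∉ sampled A h → S.walk u = currentWalk h u) : Consistent A (S :: h)

theorem consistent_of_mem_support [Fintype V] {lam : Set.Ioo (0 : ℝ) 1} {A : Adversary V k}
    {N : ℕ} {h : History V k} (hh : h ∈ (historyLaw lam A N).support) :
    Consistent A h ∧ h.length = N := by
  induction N generalizing h with
  | zero =>
    rw [historyLaw, PMF.mem_support_pure_iff] at hh
    subst hh
    exact ⟨.nil, rfl⟩
  | succ N ih =>
    rw [historyLaw, PMF.mem_support_bind_iff] at hh
    obtain ⟨g, hg, hh⟩ := hh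
    rw [PMF.mem_support_map_iff] at hh
    obtain ⟨S, hS, rfl⟩ := hh
    rw [nextLaw, PMF.mem_support_map_iff] at hS
    obtain ⟨w, hw, rfl⟩ := hS
    obtain ⟨hcons, hlen⟩ := ih hg
    refine ⟨.cons hcons rfl fun u hu => ?_, by simp [hlen]⟩
    have := Finset.prod_ne_zero_iff.1 ((PMF.mem_support_iff _ _).1 hw) u (Finset.mem_univ u)
    simp only [if_neg (show u ∉ advSample A g ∪ algSample g from hu)] at this
    exact (PMF.mem_support_pure_iff _ _).1 ((PMF.mem_support_iff _ _).2 this)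

theorem Consistent.advSampled_eq {A : Adversary V k} {h : History V k} (hh : Consistent A h)
    {S : Snapshot V k} {past : History V k} (hs : S :: past <:+ h) :
    S.advSampled = advSample A past := by
  induction hh with
  | nil => simp at hs
  | cons _ hadv _ ih =>
    rcases List.suffix_cons_iff.1 hs with he | hs
    · obtain ⟨rfl, rfl⟩ := List.cons.inj he
      exact hadv
    · exact ih hs

/-- Every walk has a last time of sampling, and has not changed since. -/
theorem Consistent.exists_last_sampled {A : Adversary V k} {h : History V k}
    (hh : Consistent A h) (hne : h ≠ []) (u : V × Fin k) :
    ∃ S past, S :: past <:+ h ∧ u ∈ sampled A past ∧ S.walk u = currentWalk h u ∧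
      ∀ S' past', S' :: past' <:+ h → past.length < past'.length → u ∉ sampled A past' := by
  induction hh with
  | nil => exact absurd rfl hne
  | @cons S h _ _ hwalk ih =>
    by_cases hu : u ∈ sampled A h
    · refine ⟨S, h, List.suffix_rfl, hu, rfl, fun S' past' hs hlt => ?_⟩
      have := hs.length_le
      simp only [List.length_cons] at this
      omega
    · have hne : h ≠ [] := by
        rintro rfl
        exact hu (Or.inl (Set.mem_univ u))
      obtain ⟨S₀, past, hs, hmem, hw, hlast⟩ := ih hne
      refine ⟨S₀, past, hs.trans (List.suffix_cons S h), hmem, hw.trans (hwalk u hu).symm, ?_⟩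
      intro S' past' hs' hlt
      rcases List.suffix_cons_iff.1 hs' with he | hs'
      · obtain ⟨-, rfl⟩ := List.cons.inj he
        exact hu
      · exact hlast S' past' hs' hlt

/-- The last sampling at time `s` is the `i`-th resampling after some sampling by the adversary
(`i = 0` if it is by the adversary). So `2 ^ i ∣ s`, and the `(i + 1)`-st resampling, due at
`s + 2 ^ (i + 2)` or earlier, is still to come. -/
theorem Consistent.length_mem_lastTimes {A : Adversary V k} {h : History V k}
    (hh : Consistent A h) {u : V × Fin k} {S : Snapshot V k} {past : History V k}
    (hs : S :: past <:+ h) (hu : u ∈ sampled A past)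
    (hlast : ∀ S' past', S' :: past' <:+ h → past.length < past'.length →
      u ∉ sampled A past') :
    past.length + 1 ∈ lastTimes h.length := by
  obtain ⟨S₀, past₀, hs₀, hu₀, i, hi⟩ : ∃ S₀ past₀, S₀ :: past₀ <:+ S :: past ∧
      u ∈ S₀.advSampled ∧ ∃ i, landmarkTime (past₀.length + 1) i = past.length + 1 := by
    rcases hu with hu | ⟨S₀, past₀, hs₀, hu₀, i, -, hi⟩
    · exact ⟨S, past, List.suffix_rfl, (hh.advSampled_eq hs).symm ▸ hu, 0, rfl⟩
    · exact ⟨S₀, past₀, hs₀.trans (List.suffix_cons S past), hu₀, i, hi⟩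
  have hnext : landmarkTime (past₀.length + 1) (i + 1) =
      nextLandmark (i + 1) (past.length + 1) := by
    rw [landmarkTime, hi]
  have hdvd : 2 ^ i ∣ past.length + 1 := by
    cases i with
    | zero => simp
    | succ i =>
      rw [← hi, landmarkTime]
      exact two_pow_dvd_nextLandmark _ _
  have hle := hs.length_le
  simp only [List.length_cons] at hle
  simp only [lastTimes, Finset.mem_filter, Finset.mem_Icc]
  refine ⟨⟨by omega, hle⟩, i, hdvd, ?_⟩
  have hgt := lt_nextLandmark (i + 1) (past.length + 1)
  refine lt_of_lt_of_le ?_ (nextLandmark_le (i + 1) (past.length + 1))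
  by_contra! hdue
  -- otherwise the walk was resampled again at the time `nextLandmark (i + 1) (past.length + 1)`
  set t := nextLandmark (i + 1) (past.length + 1) with ht
  have hlen : (h.drop (h.length - t)).length = t := by
    rw [List.length_drop]
    omega
  have hsuf := List.drop_suffix (h.length - t) h
  generalize h.drop (h.length - t) = g at hlen hsuf
  match g, hlen, hsuf with
  | [], hlen, _ => simp only [List.length_nil] at hlen; omega
  | S' :: past', hlen, hsuf =>
    simp only [List.length_cons] at hlen
    refine hlast S' past' hsuf (by omega) (Or.inr ⟨S₀, past₀, hs₀.trans ?_, hu₀, i + 1, by omega,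
      by rw [hnext, hlen]⟩)
    exact List.suffix_of_suffix_length_le hs ((List.suffix_cons S' past').trans hsuf)
      (by simp only [List.length_cons]; omega)

end Consistency

/-! ### The exponential supermartingale -/

section Supermartingale

variable {V : Type*} {k : ℕ}

open Classical in
/-- The number of times in `J` at which the walk `u` is sampled and then passes through `v`. -/
def sampledPasses (A : Adversary V k) (J : Finset ℕ) (v : V) (u : V × Fin k) : History V k → ℕ
  | [] => 0
  | S :: h => sampledPasses A J v u h +
      if h.length + 1 ∈ J ∧ u ∈ sampled A h ∧ v ∈ S.walk u then 1 else 0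

theorem one_le_sampledPasses {A : Adversary V k} {J : Finset ℕ} {v : V} {u : V × Fin k}
    {h : History V k} {S : Snapshot V k} {past : History V k} (hs : S :: past <:+ h)
    (hJ : past.length + 1 ∈ J) (hu : u ∈ sampled A past) (hv : v ∈ S.walk u) :
    1 ≤ sampledPasses A J v u h := by
  induction h with
  | nil => simp at hs
  | cons S' h ih =>
    rw [sampledPasses]
    rcases List.suffix_cons_iff.1 hs with he | hs
    · obtain ⟨rfl, rfl⟩ := List.cons.inj he
      rw [if_pos ⟨hJ, hu, hv⟩]
      omega
    · exact (ih hs).trans (Nat.le_add_right _ _)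

variable [Fintype V]

theorem Consistent.hits_le {A : Adversary V k} {h : History V k} (hh : Consistent A h)
    (hne : h ≠ []) (v : V) :
    hits h v ≤ ∑ u, sampledPasses A (lastTimes h.length) v u h := by
  classical
  unfold hits
  rw [Finset.card_filter]
  refine Finset.sum_le_sum fun u _ => ?_
  split_ifs with hv
  · obtain ⟨S, past, hs, hu, hw, hlast⟩ := hh.exists_last_sampled hne u
    exact one_le_sampledPasses hs (hh.length_mem_lastTimes hs hu hlast) hu (hw ▸ hv)
  · exact Nat.zero_le _

/-- The value that the number of walks through `v` in `G` would have if the estimate of the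
PageRank were exact. -/
def idealHits (lam : Set.Ioo (0 : ℝ) 1) (k : ℕ) (v : V) (G : Digraph V) : ℝ :=
  (Fintype.card V : ℝ) * k / lam * pageRank lam G v

theorem le_idealHits [Nonempty V] (lam : Set.Ioo (0 : ℝ) 1) (k : ℕ) (v : V) (G : Digraph V) :
    (k : ℝ) ≤ idealHits lam k v G := by
  have h0 := lam.2.1
  have hc : (0 : ℝ) < Fintype.card V := by exact_mod_cast Fintype.card_pos
  calc (k : ℝ) = (Fintype.card V : ℝ) * k / lam * (lam * (1 / (Fintype.card V : ℝ))) := by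
        field_simp
    _ ≤ _ := mul_le_mul_of_nonneg_left (le_pageRank lam G v) (by positivity)

/-- The sum of `idealHits` over the times in `J`. -/
def idealSum (lam : Set.Ioo (0 : ℝ) 1) (J : Finset ℕ) (v : V) : History V k → ℝ
  | [] => 0
  | S :: h => idealSum lam J v h + if h.length + 1 ∈ J then idealHits lam k v S.graph else 0

theorem idealSum_le {lam : Set.Ioo (0 : ℝ) 1} {J : Finset ℕ} {v : V} {h : History V k} {B : ℝ}
    (hB : 0 ≤ B) (hS : ∀ S ∈ h, idealHits lam k v S.graph ≤ B) :
    idealSum lam J v h ≤ (J.filter (· ≤ h.length)).card * B := by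
  induction h with
  | nil => rw [idealSum]; positivity
  | cons S h ih =>
    have ih := ih fun S' hS' => hS S' (List.mem_cons_of_mem S hS')
    rw [idealSum, List.length_cons]
    split_ifs with hJ
    · have hcard : (J.filter (· ≤ h.length)).card + 1 ≤ (J.filter (· ≤ h.length + 1)).card := by
        rw [← Finset.card_insert_of_notMem (a := h.length + 1) (by simp)]
        refine Finset.card_le_card fun s hs => ?_
        simp only [Finset.mem_insert, Finset.mem_filter] at hs ⊢
        rcases hs with rfl | ⟨h1, h2⟩
        · exact ⟨hJ, le_rfl⟩
        · exact ⟨h1, by omega⟩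
      have hcard' : ((J.filter (· ≤ h.length)).card : ℝ) + 1
          ≤ (J.filter (· ≤ h.length + 1)).card := by exact_mod_cast hcard
      nlinarith [hS S List.mem_cons_self]
    · rw [add_zero]
      refine ih.trans (mul_le_mul_of_nonneg_right ?_ hB)
      exact_mod_cast Finset.card_le_card
        (Finset.monotone_filter_right J fun s _ hs => Nat.le_succ_of_le hs)

/-- The exponential supermartingale: a factor `2` for every passage through `v` of a walk that is
sampled at a time in `J`, against the exponential of the `idealHits` at the times in `J`. -/
def expWeight (lam : Set.Ioo (0 : ℝ) 1) (A : Adversary V k) (J : Finset ℕ) (v : V)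
    (h : History V k) : ℝ≥0∞ :=
  2 ^ (∑ u, sampledPasses A J v u h) * ENNReal.ofReal (Real.exp (-idealSum lam J v h))

open Classical in
theorem expect_two_pow_le [Nonempty V] (lam : Set.Ioo (0 : ℝ) 1) (A : Adversary V k)
    (h : History V k) (v : V) :
    expect (nextLaw lam A h)
        (fun S => 2 ^ (∑ u, if u ∈ sampled A h ∧ v ∈ S.walk u then 1 else 0)) ≤
      ENNReal.ofReal (Real.exp (idealHits lam k v (A.graph h))) := by
  set q : V → ℝ := fun w => (hitProb lam (A.graph h) v w).toReal with hq
  rw [nextLaw, expect_map]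
  simp only [← Finset.prod_pow_eq_pow_sum]
  rw [expect_prodPMF _
    (fun u (p : List V) => (2 : ℝ≥0∞) ^ (if u ∈ sampled A h ∧ v ∈ p then 1 else 0))]
  have hfactor : ∀ u : V × Fin k,
      expect (if u ∈ advSample A h ∪ algSample h then walkLaw lam (A.graph h) u.1
          else PMF.pure (currentWalk h u))
        (fun p : List V => (2 : ℝ≥0∞) ^ (if u ∈ sampled A h ∧ v ∈ p then 1 else 0)) ≤
      ENNReal.ofReal (Real.exp (q u.1)) := by
    intro u
    by_cases hu : u ∈ sampled A h
    · rw [if_pos (show u ∈ advSample A h ∪ algSample h from hu)]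
      have : (fun p : List V => (2 : ℝ≥0∞) ^ (if u ∈ sampled A h ∧ v ∈ p then 1 else 0)) =
          fun p => 1 + passes v p := by
        funext p
        by_cases hv : v ∈ p <;> simp [passes, hu, hv, one_add_one_eq_two]
      rw [this, expect_add, expect_const]
      have hfin : hitProb lam (A.graph h) v u.1 ≠ ∞ :=
        ((hitProb_le_one lam (A.graph h) v u.1).trans_lt ENNReal.one_lt_top).ne
      change 1 + hitProb lam (A.graph h) v u.1 ≤ _
      rw [← ENNReal.ofReal_toReal hfin, ← ENNReal.ofReal_one,
        ← ENNReal.ofReal_add zero_le_one ENNReal.toReal_nonneg]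
      refine ENNReal.ofReal_le_ofReal ?_
      rw [add_comm]
      exact Real.add_one_le_exp _
    · simp only [hu, false_and, if_false, pow_zero]
      rw [expect_const, ENNReal.one_le_ofReal]
      exact Real.one_le_exp ENNReal.toReal_nonneg
  refine (Finset.prod_le_prod' fun u _ => hfactor u).trans ?_
  rw [← ENNReal.ofReal_prod_of_nonneg fun _ _ => (Real.exp_pos _).le, ← Real.exp_sum]
  refine ENNReal.ofReal_le_ofReal (Real.exp_le_exp.2 ?_)
  rw [Fintype.sum_prod_type]
  simp only [Finset.sum_const, Finset.card_univ, Fintype.card_fin, nsmul_eq_mul]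
  rw [← Finset.mul_sum]
  calc (k : ℝ) * ∑ w, q w
      ≤ k * (Fintype.card V / lam * pageRank lam (A.graph h) v) :=
        mul_le_mul_of_nonneg_left (sum_hitProb_le lam (A.graph h) v) (Nat.cast_nonneg k)
    _ = _ := by rw [idealHits]; ring

theorem expect_expWeight_next_le [Nonempty V] (lam : Set.Ioo (0 : ℝ) 1) (A : Adversary V k)
    (J : Finset ℕ) (v : V) (h : History V k) :
    expect (nextLaw lam A h) (fun S => expWeight lam A J v (S :: h)) ≤ expWeight lam A J v h := by
  classical
  by_cases hJ : h.length + 1 ∈ J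
  · have hgraph : ∀ S ∈ (nextLaw lam A h).support, S.graph = A.graph h := by
      intro S hS
      rw [nextLaw, PMF.mem_support_map_iff] at hS
      obtain ⟨w, -, rfl⟩ := hS
      rfl
    calc expect (nextLaw lam A h) (fun S => expWeight lam A J v (S :: h))
        ≤ expect (nextLaw lam A h) (fun S =>
            expWeight lam A J v h * ENNReal.ofReal (Real.exp (-idealHits lam k v (A.graph h))) *
              2 ^ (∑ u, if u ∈ sampled A h ∧ v ∈ S.walk u then 1 else 0)) := by
          refine expect_mono _ fun S hS => le_of_eq ?_
          simp only [expWeight, sampledPasses, idealSum, hJ, true_and, if_true, hgraph S hS,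
            Finset.sum_add_distrib, pow_add, neg_add, Real.exp_add,
            ENNReal.ofReal_mul (Real.exp_pos _).le]
          ring
      _ ≤ expWeight lam A J v h * ENNReal.ofReal (Real.exp (-idealHits lam k v (A.graph h))) *
            ENNReal.ofReal (Real.exp (idealHits lam k v (A.graph h))) := by
          rw [expect_mul_left]
          gcongr
          exact expect_two_pow_le lam A h v
      _ = expWeight lam A J v h := by
          rw [mul_assoc, ← ENNReal.ofReal_mul (Real.exp_pos _).le, ← Real.exp_add,
            neg_add_cancel, Real.exp_zero, ENNReal.ofReal_one, mul_one]
  · simp only [expWeight, sampledPasses, idealSum, hJ, false_and, if_false, add_zero]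
    rw [expect_const]

theorem expect_expWeight_le_one [Nonempty V] (lam : Set.Ioo (0 : ℝ) 1) (A : Adversary V k)
    (J : Finset ℕ) (v : V) (N : ℕ) : expect (historyLaw lam A N) (expWeight lam A J v) ≤ 1 := by
  induction N with
  | zero =>
    rw [historyLaw, expect_pure]
    simp [expWeight, sampledPasses, idealSum]
  | succ N ih =>
    rw [historyLaw, expect_bind]
    simp only [expect_map]
    exact (expect_mono _ fun h _ => expect_expWeight_next_le lam A J v h).trans ih

end Supermartingale

/-! ### Failure probabilities -/

section Failure

variable {V : Type*} [Fintype V] {k : ℕ}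

theorem pageRank_le_maxPageRank (lam : ℝ) {h : History V k} {S : Snapshot V k} (hS : S ∈ h)
    (v : V) : pageRank lam S.graph v ≤ maxPageRank lam h v := by
  unfold maxPageRank
  induction h with
  | nil => simp at hS
  | cons S' h ih =>
    rw [List.map_cons, List.foldr_cons]
    rcases List.mem_cons.1 hS with rfl | hS
    · exact le_max_left _ _
    · exact (ih hS).trans (le_max_right _ _)

/-- The estimate for `v` exceeds the bound after the history. -/
def Exceeds (lam : Set.Ioo (0 : ℝ) 1) (C : ℝ) (h : History V k) (v : V) : Prop :=
  1 ≤ h.length ∧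
    maxPageRank lam h v * (C * Real.log (h.length + 1)) < estPageRank lam h v

/-- If the estimate exceeds the bound, then the supermartingale of the possible last sampling times
is large: at the end of a history of length `T` there are at most `12 * log (T + 1)` such times, and
`idealHits` is at least `k`, so at least `κ * log n` for `n` nodes. -/
theorem Exceeds.le_expWeight [Nonempty V] {lam : Set.Ioo (0 : ℝ) 1} {A : Adversary V k}
    {κ D : ℝ} (hκ : 0 < κ) (hD : 0 ≤ D) (hk : κ * Real.log (Fintype.card V) ≤ k)
    {h : History V k} (hh : Consistent A h) {v : V}
    (hex : Exceeds lam ((12 + D / κ) / Real.log 2) h v) :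
    ENNReal.ofReal (Real.exp (D * Real.log (h.length + 1) * Real.log (Fintype.card V))) ≤
      expWeight lam A (lastTimes h.length) v h := by
  obtain ⟨hlen, hex⟩ := hex
  have h0 := lam.2.1
  set L := Real.log (h.length + 1) with hL
  have hL0 : 0 ≤ L := Real.log_nonneg (by linarith [(Nat.cast_nonneg h.length : (0 : ℝ) ≤ _)])
  have hne : h ≠ [] := List.length_pos_iff.1 hlen
  obtain ⟨S, hS⟩ := List.exists_mem_of_ne_nil h hne
  set M := (Fintype.card V : ℝ) * k / lam * maxPageRank lam h v with hM
  have hideal : ∀ S ∈ h, idealHits lam k v S.graph ≤ M := fun S hS =>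
    mul_le_mul_of_nonneg_left (pageRank_le_maxPageRank _ hS v) (by positivity)
  have hkM : (k : ℝ) ≤ M := (le_idealHits lam k v S.graph).trans (hideal S hS)
  have hM0 : 0 ≤ M := (Nat.cast_nonneg k).trans hkM
  have hmax : 0 ≤ maxPageRank lam h v :=
    (pageRank_nonneg lam S.graph v).trans (pageRank_le_maxPageRank _ hS v)
  have hlog2 : 0 < Real.log 2 := Real.log_pos one_lt_two
  have hhits : M * ((12 + D / κ) * L) ≤ hits h v * Real.log 2 := by
    have hpos : 0 < (Fintype.card V : ℝ) * k / lam := by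
      refine lt_of_le_of_ne (by positivity) fun h0 => ?_
      -- without walks the estimate is the junk value `0`
      rw [estPageRank, ← h0, div_zero] at hex
      have : 0 ≤ maxPageRank lam h v * ((12 + D / κ) / Real.log 2 * L) := by positivity
      linarith
    rw [estPageRank, lt_div_iff₀ hpos] at hex
    calc M * ((12 + D / κ) * L)
        = maxPageRank lam h v * ((12 + D / κ) / Real.log 2 * L) *
            ((Fintype.card V : ℝ) * k / lam) * Real.log 2 := by
          rw [hM]
          field_simp
      _ ≤ _ := mul_le_mul_of_nonneg_right hex.le hlog2.le
  have hpass : (hits h v : ℝ) ≤ (∑ u, sampledPasses A (lastTimes h.length) v u h : ℕ) := by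
    exact_mod_cast hh.hits_le hne v
  have hsum : idealSum lam (lastTimes h.length) v h ≤ 12 * L * M := by
    refine (idealSum_le hM0 hideal).trans (mul_le_mul_of_nonneg_right ?_ hM0)
    refine le_trans ?_ (card_lastTimes_le_log hlen)
    exact_mod_cast Finset.card_filter_le _ _
  have hpow : (2 : ℝ≥0∞) ^ (∑ u, sampledPasses A (lastTimes h.length) v u h) = ENNReal.ofReal
      (Real.exp ((∑ u, sampledPasses A (lastTimes h.length) v u h : ℕ) * Real.log 2)) := by
    rw [← Real.log_pow, Real.exp_log (by positivity), ENNReal.ofReal_pow zero_le_two,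
      ENNReal.ofReal_ofNat]
  rw [expWeight, hpow, ← ENNReal.ofReal_mul (Real.exp_pos _).le, ← Real.exp_add]
  refine ENNReal.ofReal_le_ofReal (Real.exp_le_exp.2 ?_)
  have h1 := mul_le_mul_of_nonneg_right hpass hlog2.le
  -- the part `D / κ` of the constant remains after the compensator has used up the part `12`
  have h2 : D * L * Real.log (Fintype.card V) ≤ D / κ * L * M := by
    calc D * L * Real.log (Fintype.card V) = D / κ * L * (κ * Real.log (Fintype.card V)) := by
          field_simp
      _ ≤ _ := mul_le_mul_of_nonneg_left (hk.trans hkM) (by positivity)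
  nlinarith

/-- The union bound over the nodes at time `T` leaves a summable failure probability. -/
theorem card_mul_exp_le {c x : ℝ} (hc : 0 < c) (hx : 2 ≤ x) {T : ℕ} (hT : 1 ≤ T) :
    x * Real.exp (-((2 * c + 6) * Real.log (T + 1) * Real.log x)) ≤
      x ^ (-c) * (1 / T - 1 / (T + 1)) := by
  have hT' : (1 : ℝ) ≤ T := by exact_mod_cast hT
  have hx0 : 0 < x := by linarith
  have hlx : 1 / 2 ≤ Real.log x := by
    linarith [Real.log_le_log two_pos hx, Real.log_two_gt_d9]
  have hlT : 1 / 2 ≤ Real.log ((T : ℝ) + 1) := by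
    linarith [Real.log_le_log two_pos (by linarith : (2 : ℝ) ≤ T + 1), Real.log_two_gt_d9]
  calc x * Real.exp (-((2 * c + 6) * Real.log (T + 1) * Real.log x))
      = Real.exp (Real.log x - (2 * c + 6) * Real.log (T + 1) * Real.log x) := by
        rw [sub_eq_add_neg, Real.exp_add, Real.exp_log hx0]
    _ ≤ Real.exp (Real.log x * (-c) + Real.log (T + 1) * (-2)) := by
        refine Real.exp_le_exp.2 ?_
        have h1 : 0 ≤ (c + 1) * Real.log x * (2 * Real.log ((T : ℝ) + 1) - 1) :=
          mul_nonneg (mul_nonneg (by linarith) (by linarith)) (by linarith)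
        have h2 : 0 ≤ 2 * Real.log ((T : ℝ) + 1) * (2 * Real.log x - 1) :=
          mul_nonneg (by linarith) (by linarith)
        linarith
    _ = x ^ (-c) * (((T : ℝ) + 1) ^ 2)⁻¹ := by
        rw [Real.exp_add, ← Real.rpow_def_of_pos hx0, ← Real.rpow_def_of_pos (by linarith),
          Real.rpow_neg (by linarith : (0 : ℝ) ≤ T + 1), Real.rpow_two]
    _ ≤ _ := by
        refine mul_le_mul_of_nonneg_left ?_ (Real.rpow_nonneg hx0.le _)
        rw [div_sub_div _ _ (by positivity) (by positivity), inv_eq_one_div,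
          div_le_div_iff₀ (by positivity) (by positivity)]
        nlinarith

open Classical in
theorem expect_exceeds_le [Nonempty V] (lam : Set.Ioo (0 : ℝ) 1) (A : Adversary V k) {κ c : ℝ}
    (hκ : 0 < κ) (hc : 0 < c) (hV : 2 ≤ Fintype.card V)
    (hk : κ * Real.log (Fintype.card V) ≤ k) {T : ℕ} (hT : 1 ≤ T) :
    expect (historyLaw lam A T) (fun h =>
        if ∃ v, Exceeds lam ((12 + (2 * c + 6) / κ) / Real.log 2) h v then 1 else 0) ≤
      ENNReal.ofReal ((Fintype.card V : ℝ) ^ (-c) * (1 / T - 1 / (T + 1))) := by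
  set a := (2 * c + 6) * Real.log (T + 1) * Real.log (Fintype.card V) with ha
  have hmarkov : ∀ h ∈ (historyLaw lam A T).support,
      (if ∃ v, Exceeds lam ((12 + (2 * c + 6) / κ) / Real.log 2) h v then (1 : ℝ≥0∞) else 0) ≤
        ∑ v, ENNReal.ofReal (Real.exp (-a)) * expWeight lam A (lastTimes T) v h := by
    intro h hsupp
    obtain ⟨hh, rfl⟩ := consistent_of_mem_support hsupp
    split_ifs with hex
    · obtain ⟨v, hex⟩ := hex
      calc (1 : ℝ≥0∞)
          = ENNReal.ofReal (Real.exp (-a)) * ENNReal.ofReal (Real.exp a) := by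
            rw [← ENNReal.ofReal_mul (Real.exp_pos _).le, ← Real.exp_add, neg_add_cancel,
              Real.exp_zero, ENNReal.ofReal_one]
        _ ≤ ENNReal.ofReal (Real.exp (-a)) * expWeight lam A (lastTimes h.length) v h := by
            gcongr
            exact hex.le_expWeight hκ (by linarith) hk hh
        _ ≤ _ := Finset.single_le_sum
            (f := fun v => ENNReal.ofReal (Real.exp (-a)) *
              expWeight lam A (lastTimes h.length) v h)
            (fun _ _ => zero_le) (Finset.mem_univ v)
    · exact zero_le
  refine (expect_mono _ hmarkov).trans ?_
  have hswap : expect (historyLaw lam A T)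
      (fun h => ∑ v, ENNReal.ofReal (Real.exp (-a)) * expWeight lam A (lastTimes T) v h) =
      ∑ v, ENNReal.ofReal (Real.exp (-a)) *
        expect (historyLaw lam A T) (expWeight lam A (lastTimes T) v) := by
    simp only [← expect_mul_left]
    simp only [expect, Finset.mul_sum]
    exact Summable.tsum_finsetSum fun _ _ => ENNReal.summable
  rw [hswap]
  calc ∑ v : V, ENNReal.ofReal (Real.exp (-a)) *
        expect (historyLaw lam A T) (expWeight lam A (lastTimes T) v)
      ≤ ∑ _v : V, ENNReal.ofReal (Real.exp (-a)) :=
        Finset.sum_le_sum fun v _ =>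
          mul_le_of_le_one_right' (expect_expWeight_le_one lam A (lastTimes T) v T)
    _ = ENNReal.ofReal (Fintype.card V * Real.exp (-a)) := by
        rw [Finset.sum_const, Finset.card_univ, nsmul_eq_mul,
          ENNReal.ofReal_mul (Nat.cast_nonneg _), ENNReal.ofReal_natCast]
    _ ≤ _ := ENNReal.ofReal_le_ofReal (card_mul_exp_le hc (by exact_mod_cast hV) hT)

open Classical in
/-- The failure probabilities of the times `1, …, N` sum up to a telescoping series. -/
theorem expect_exists_suffix_exceeds_le [Nonempty V] (lam : Set.Ioo (0 : ℝ) 1)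
    (A : Adversary V k) {κ c : ℝ} (hκ : 0 < κ) (hc : 0 < c) (hV : 2 ≤ Fintype.card V)
    (hk : κ * Real.log (Fintype.card V) ≤ k) (N : ℕ) :
    expect (historyLaw lam A N) (fun H =>
        if ∃ h, h <:+ H ∧ ∃ v, Exceeds lam ((12 + (2 * c + 6) / κ) / Real.log 2) h v
          then 1 else 0) ≤
      ENNReal.ofReal ((Fintype.card V : ℝ) ^ (-c) * (1 - 1 / (N + 1))) := by
  set C := (12 + (2 * c + 6) / κ) / Real.log 2 with hC
  induction N with
  | zero =>
    rw [historyLaw, expect_pure, if_neg]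
    · exact zero_le
    · rintro ⟨h, hs, v, hlen, -⟩
      rw [List.suffix_nil.1 hs] at hlen
      simp at hlen
  | succ N ih =>
    have hsplit : ∀ H : History V k,
        (if ∃ h, h <:+ H ∧ ∃ v, Exceeds lam C h v then (1 : ℝ≥0∞) else 0) ≤
          (if ∃ h, h <:+ H.tail ∧ ∃ v, Exceeds lam C h v then 1 else 0) +
            (if ∃ v, Exceeds lam C H v then 1 else 0) := by
      intro H
      split_ifs with h1 h2 h3 h3
      · simp
      · simp
      · simp
      · exfalso
        obtain ⟨h, hs, hex⟩ := h1
        match H, hs with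
        | [], hs => exact h3 (List.suffix_nil.1 hs ▸ hex)
        | S :: H, hs =>
          rcases List.suffix_cons_iff.1 hs with rfl | hs
          · exact h3 hex
          · exact h2 ⟨h, hs, hex⟩
      all_goals simp
    refine (expect_mono _ fun H _ => hsplit H).trans ?_
    rw [expect_add]
    have htail : expect (historyLaw lam A (N + 1))
        (fun H => if ∃ h, h <:+ H.tail ∧ ∃ v, Exceeds lam C h v then 1 else 0) =
        expect (historyLaw lam A N)
          (fun H => if ∃ h, h <:+ H ∧ ∃ v, Exceeds lam C h v then 1 else 0) := by
      rw [historyLaw, expect_bind]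
      simp only [expect_map, List.tail_cons]
      exact congrArg _ (funext fun h => expect_const (nextLaw lam A h)
        (if ∃ g, g <:+ h ∧ ∃ v, Exceeds lam C g v then 1 else 0))
    rw [htail]
    refine (add_le_add ih
      (expect_exceeds_le lam A hκ hc hV hk (Nat.succ_le_succ (Nat.zero_le N)))).trans_eq ?_
    have hN : (0 : ℝ) < N + 1 := by positivity
    have h1 : 1 / ((N : ℝ) + 1) ≤ 1 := by
      rw [div_le_one hN]
      linarith [(Nat.cast_nonneg N : (0 : ℝ) ≤ N)]
    have h2 : 1 / ((N : ℝ) + 1 + 1) ≤ 1 / (N + 1) :=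
      one_div_le_one_div_of_le hN (by linarith)
    have hx : (0 : ℝ) ≤ (Fintype.card V : ℝ) ^ (-c) := by positivity
    push_cast
    rw [← ENNReal.ofReal_add (mul_nonneg hx (by linarith)) (mul_nonneg hx (by linarith))]
    congr 1
    ring

end Failure

end DynPageRank

end

theorem mainTheorem8 :
    ∀ κ : ℝ, 0 < κ → ∀ c : ℝ, 0 < c →
      ∃ C : ℝ, 0 < C ∧
        ∀ (n : ℕ), 1 ≤ n →
        ∀ (lam : Set.Ioo (0 : ℝ) 1) (k : ℕ), κ * Real.log n ≤ k →
        ∀ (A : DynPageRank.Adversary (Fin n) k) (N : ℕ),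
          ENNReal.ofReal (1 - (n : ℝ) ^ (-c)) ≤
            (DynPageRank.historyLaw lam A N).toOuterMeasure
              {H | ∀ h : DynPageRank.History (Fin n) k, h <:+ H → 1 ≤ h.length →
                ∀ v : Fin n,
                  DynPageRank.estPageRank lam h v ≤
                    DynPageRank.maxPageRank lam h v * (C * Real.log (h.length + 1))} := by
  classical
  intro κ hκ c hc
  refine ⟨(12 + (2 * c + 6) / κ) / Real.log 2,
    div_pos (by positivity) (Real.log_pos one_lt_two), fun n hn lam k hk A N => ?_⟩
  -- for a single node the claimed probability is `0`
  obtain rfl | hn2 : n = 1 ∨ 2 ≤ n := by omega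
  · simp
  have : Nonempty (Fin n) := ⟨⟨0, hn⟩⟩
  set p := DynPageRank.historyLaw lam A N with hp
  set E := {H : DynPageRank.History (Fin n) k | ∀ h : DynPageRank.History (Fin n) k, h <:+ H →
    1 ≤ h.length → ∀ v : Fin n, DynPageRank.estPageRank lam h v ≤
      DynPageRank.maxPageRank lam h v *
        ((12 + (2 * c + 6) / κ) / Real.log 2 * Real.log (h.length + 1))} with hE
  have hfail : p.toOuterMeasure Eᶜ ≤ ENNReal.ofReal ((n : ℝ) ^ (-c)) := by
    have hbound := DynPageRank.expect_exists_suffix_exceeds_le lam A hκ hc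
      (by simpa using hn2) (by simpa using hk) N
    rw [Fintype.card_fin] at hbound
    rw [DynPageRank.toOuterMeasure_eq_expect]
    refine le_trans (DynPageRank.expect_mono _ fun H _ => ?_) (hbound.trans ?_)
    · split_ifs with h1 h2 h2
      · exact le_rfl
      · exfalso
        refine h1 fun h hs hlen v => ?_
        by_contra! hlt
        exact h2 ⟨h, hs, v, hlen, hlt⟩
      · exact zero_le
      · exact le_rfl
    · refine ENNReal.ofReal_le_ofReal (mul_le_of_le_one_right (by positivity) ?_)
      have : (0 : ℝ) ≤ 1 / (N + 1) := by positivity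
      linarith
  have hone : 1 ≤ p.toOuterMeasure E + p.toOuterMeasure Eᶜ := by
    refine le_trans ?_ (MeasureTheory.measure_union_le E Eᶜ)
    rw [Set.union_compl_self]
    exact ((p.toOuterMeasure_apply_eq_one_iff _).2 (Set.subset_univ _)).ge
  rw [ENNReal.ofReal_sub _ (by positivity), ENNReal.ofReal_one, tsub_le_iff_right]
  exact hone.trans (by gcongr)
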